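/- Let $\mathcal{E}$ be an elementary topos, i.e. a cartesian closed category with finite limits and a subobject classifier. A context $\Gamma$ is a finite list of objects (types), interpreted by their product (also written $\Gamma$); a formula $\psi$ in context $\Gamma, x:A$ is a subobject of $\Gamma\times A$; a term $\Gamma\mid t:A$ is an arrow $t:\Gamma\to A$; $\psi[t/x]$ is the pullback of $\psi$ along $\langle \mathrm{id}_\Gamma,t\rangle:\Gamma\to\Gamma\times A$; $\exists x{:}A.\,\psi$ is the image of $\psi$ under the projection $\pi_\Gamma:\Gamma\times A\to\Gamma$; and $\Gamma\mid\phi\vdash\chi$ means $\phi\le\chi$ as subobjects of $\Gamma$. The following are equivalent. (i) The internal logic of $\mathcal{E}$ is the full $\varepsilon$-calculus: for every non-initial object $A$, every context $\Gamma$ none of whose types is initial, and every formula $\psi$ in context $\Gamma,x:A$, there is a term $\Gamma\mid\varepsilon_\psi:A$ such that $\Gamma\mid\exists x{:}A.\,\psi\vdash\psi[\varepsilon_\psi/x]$. (i') For all objects $\Gamma$ and $A$ of $\mathcal{E}$ with $A$ non-initial and every mono $\varphi:X\rightarrowtail\Gamma\times A$, there is an arrow $\varepsilon_\varphi:\Gamma\to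 A$ such that the pullback of $\varphi$ along $\langle\mathrm{id}_\Gamma,\varepsilon_\varphi\rangle$ equals, as a subobject of $\Gamma$, the image of $\pi_\Gamma\varphi$. (ii) $\mathcal{E}$ is an $\varepsilon$-topos: every epimorphism of $\mathcal{E}$ has a section, and for every non-initial object $A$ the unique arrow $A\to 1$ is epic. -/

import Mathlib

open CategoryTheory Limits MonoidalCategory CartesianMonoidalCategory

universe v u

namespace EpsilonTopos

/-! Throughout, an elementary topos is a cartesian closed category
(`CartesianMonoidalCategory` and `MonoidalClosed`) with finite limits and a subobject classifier. -/

section Images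

variable {C : Type u} [Category.{v} C]

/-- The constant map with value "true". -/
def trueMap (c : Subobject.Classifier C) (X : C) : X ⟶ c.Ω := c.χ₀ X ≫ c.truth

theorem comp_trueMap (c : Subobject.Classifier C) {X Y : C} (f : X ⟶ Y) :
    f ≫ trueMap c Y = trueMap c X := by
  unfold trueMap
  rw [← Category.assoc, c.isTerminalΩ₀.hom_ext (f ≫ c.χ₀ Y) (c.χ₀ X)]

variable [CartesianMonoidalCategory C] [MonoidalClosed C] [HasFiniteLimits C]
  [HasSubobjectClassifier C]

open MonoidalClosed in
/-- An elementary topos has images: the image of `f : X ⟶ Y` is the internal intersection of all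
subobjects of `Y` through which `f` factors. -/
instance hasImages : HasImages C where
  has_image {X Y} f := by
    obtain ⟨c⟩ := HasSubobjectClassifier.exists_classifier (C := C)
    let a : (ihom Y).obj c.Ω ⟶ (ihom X).obj c.Ω := (pre f).app c.Ω
    let b : (ihom Y).obj c.Ω ⟶ (ihom X).obj c.Ω := curry (trueMap c _)
    let w := equalizer.ι a b
    have hw : f ▷ _ ≫ uncurry w = trueMap c _ := by
      rw [← uncurry_pre_app]
      change uncurry (w ≫ a) = _
      rw [equalizer.condition a b, uncurry_natural_left, uncurry_curry, comp_trueMap]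
    let G : equalizer a b ⊗ Y ⟶ c.Ω := lift (snd _ _) (fst _ _) ≫ uncurry w
    let i := equalizer.ι (curry G) (curry (trueMap c _))
    have hi : equalizer a b ◁ i ≫ G = trueMap c _ := by
      apply curry_injective
      rw [curry_natural_left, equalizer.condition (curry G) (curry (trueMap c _)),
        ← curry_natural_left, comp_trueMap]
    have hf : f ≫ curry G = f ≫ curry (trueMap c _) := by
      rw [← curry_natural_left, ← curry_natural_left, comp_trueMap]
      have : equalizer a b ◁ f ≫ G = lift (snd _ _) (fst _ _) ≫ f ▷ _ ≫ uncurry w := by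
        simp only [G, ← Category.assoc]
        congr 1
        ext <;> simp
      rw [this, hw, comp_trueMap]
    let F : MonoFactorisation f :=
      { I := equalizer (curry G) (curry (trueMap c _))
        m := i
        e := equalizer.lift f hf
        fac := equalizer.lift_ι f hf }
    have key (F' : MonoFactorisation f) : ∃ l : F.I ⟶ F'.I, l ≫ F'.m = F.m := by
      have hχ : f ≫ c.χ F'.m = trueMap c X := by
        have h : (F'.e ≫ F'.m) ≫ c.χ F'.m = trueMap c X := by
          rw [Category.assoc, (c.isPullback F'.m).w]
          exact comp_trueMap c F'.e
        rwa [F'.fac] at h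
      let p : 𝟙_ C ⟶ (ihom Y).obj c.Ω := curry (fst _ _ ≫ c.χ F'.m)
      have hp : p ≫ a = p ≫ b := by
        have h1 : p ≫ a = curry (f ▷ _ ≫ fst _ _ ≫ c.χ F'.m) := curry_pre_app _ _
        rw [h1, ← curry_natural_left, comp_trueMap, whiskerRight_fst_assoc, hχ, comp_trueMap]
      let l := equalizer.lift p hp
      have hl : l ≫ w = p := equalizer.lift_ι p hp
      have h1 : lift (toUnit F.I ≫ l) (𝟙 F.I) ≫ equalizer a b ◁ i ≫ G = trueMap c F.I := by
        rw [hi, comp_trueMap]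
      have h2 : lift (toUnit F.I ≫ l) (𝟙 F.I) ≫ equalizer a b ◁ i ≫ G = i ≫ c.χ F'.m := by
        have : lift (toUnit F.I ≫ l) (𝟙 F.I) ≫ equalizer a b ◁ i ≫ lift (snd _ _) (fst _ _) =
            lift i (toUnit F.I) ≫ Y ◁ l := by
          ext <;> simp
        calc _ = (lift (toUnit F.I ≫ l) (𝟙 F.I) ≫ equalizer a b ◁ i ≫
                lift (snd _ _) (fst _ _)) ≫ uncurry w := by simp only [G, Category.assoc]
          _ = lift i (toUnit F.I) ≫ uncurry (l ≫ w) := by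
              rw [this, uncurry_natural_left, Category.assoc]
          _ = _ := by rw [hl]; simp [p]
      have h3 : i ≫ c.χ F'.m = c.χ₀ F.I ≫ c.truth := h2.symm.trans h1
      exact ⟨(c.isPullback F'.m).lift i _ h3, (c.isPullback F'.m).lift_fst _ _ _⟩
    choose l hl using key
    exact ⟨⟨⟨F, ⟨l, hl⟩⟩⟩⟩

end Images

section InternalLogic

variable {C : Type u} [Category.{v} C]

/-- `A` is an initial object, that is, the empty type. -/
def IsInitialObj (A : C) : Prop := Nonempty (IsInitial A)

variable [CartesianMonoidalCategory C]

/-- The object interpreting a context, a finite list of types (the head being the type of the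
variable declared last): the product of its types. -/
def ctxObj : List C → C
  | [] => 𝟙_ C
  | A :: Γ => ctxObj Γ ⊗ A

/-- A term `Γ ∣ t : A` is an arrow from the product of the types in `Γ` to `A`. -/
abbrev Term (Γ : List C) (A : C) := ctxObj Γ ⟶ A

/-- A formula in context `Γ` is a (class of a) monic arrow into the product of the types in `Γ`. -/
abbrev Formula (Γ : List C) := Subobject (ctxObj Γ)

/-- The sequent `Γ ∣ φ ⊢ χ`: the monic arrow representing `φ` factors through the one
representing `χ`. -/
def Entails {Γ : List C} (φ χ : Formula Γ) : Prop := φ ≤ χ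

variable [HasFiniteLimits C]

/-- The formula `ψ[t/x]` in context `Γ`, for `ψ` in context `Γ, x : A` and `Γ ∣ t : A`: the
pullback of `ψ` along `⟨id, t⟩`. -/
noncomputable def substLast {Γ : List C} {A : C} (ψ : Formula (A :: Γ)) (t : Term Γ A) :
    Formula Γ :=
  (Subobject.pullback (lift (𝟙 (ctxObj Γ)) t)).obj ψ

variable [MonoidalClosed C] [HasSubobjectClassifier C]

/-- The formula `∃ x : A. ψ` in context `Γ`, for `ψ` in context `Γ, x : A`: the image of `ψ`
under the projection `Γ × A ⟶ Γ`. -/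
noncomputable def existsLast {Γ : List C} {A : C} (ψ : Formula (A :: Γ)) : Formula Γ :=
  (Subobject.exists (fst (ctxObj Γ) A)).obj ψ

variable (C)

/-- The internal logic of the topos `C` is the full epsilon calculus: for `A` not the empty type,
`Γ` a context in which the empty type does not appear and `ψ` a formula in context `Γ, x : A`,
there is a term `Γ ∣ ε : A` such that `Γ ∣ ∃ x : A. ψ ⊢ ψ[ε/x]`. -/
def IsFullEpsilonCalculus : Prop :=
  ∀ (Γ : List C) (A : C), (∀ B ∈ Γ, ¬ IsInitialObj B) → ¬ IsInitialObj A →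
    ∀ ψ : Formula (A :: Γ), ∃ ε : Term Γ A, Entails (existsLast ψ) (substLast ψ ε)

/-- The form of the full epsilon calculus in terms of arrows: for all objects `Γ` and `A` with `A`
not initial and every monic arrow `φ : X ⟶ Γ ⊗ A` there is an arrow `ε : Γ ⟶ A` such that the
pullback of `φ` along `⟨id, ε⟩` is the image of `φ` under the projection to `Γ`. -/
def HasEpsilonArrows : Prop :=
  ∀ (Γ A : C), ¬ IsInitialObj A → ∀ (X : C) (φ : X ⟶ Γ ⊗ A) [Mono φ], ∃ ε : Γ ⟶ A,
    (Subobject.pullback (lift (𝟙 Γ) ε)).obj (Subobject.mk φ) =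
      (Subobject.exists (fst Γ A)).obj (Subobject.mk φ)

end InternalLogic

/-- `C` is an `ε`-topos: every epimorphism has a section, and `A ⟶ 1` is epic for every
non-initial object `A`. -/
def IsEpsilonTopos (C : Type u) [Category.{v} C] [CartesianMonoidalCategory C] : Prop :=
  (∀ ⦃X Y : C⦄ (f : X ⟶ Y), Epi f → ∃ s : Y ⟶ X, s ≫ f = 𝟙 Y) ∧
    ∀ A : C, ¬ IsInitialObj A → Epi (toUnit A)

end EpsilonTopos

/-!
That arrows `ε` give the full epsilon calculus, and that the latter gives an `ε`-topos, is direct. A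
term `ε` for the formula `f x = y` in the context `y : Y, x : X` is a section of the epimorphism
`f : X ⟶ Y`; if `X` is initial, then `f` is monic as well and hence invertible. A term of type `A`
in the empty context is a section of `A ⟶ 1`.

To find the arrow `ε` for a monic arrow `φ` in an `ε`-topos, let `R` be the subobject
`{(γ, a) | φ(γ, a) ↔ ∃ x, φ(γ, x)}` of `Γ × A`. A section of the projection `R ⟶ Γ` yields the arrow
`ε`, so it suffices that this projection is epic (`IsEpsilonTopos.hasEpsilonArrows`). Every global
element `γ` of `Γ` lifts to `R`: the image of `φ` in `Γ` either contains `γ`, and then a witness is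
found by splitting the epimorphism onto the image, or does not, and then any element of `A` will do,
since truth values over `1` are only `⊤` and `⊥`.

There remains to show that an arrow is epic if all global elements lift through it
(`IsEpsilonTopos.epi_of_forall_point`), or equivalently that a truth value `p : X ⟶ Ω` which is true
at all global elements is true (`IsEpsilonTopos.eq_trueMap`). This would be easy in a Boolean topos,
because objects without global elements are initial. Booleanness itself is not needed: negated
truth values are determined by their global instances (`IsEpsilonTopos.neg_eq_neg`), and a variant
of Diaconescu's argument reduces `p` to such values. Splitting the epimorphism from `X × Ω` onto the
image of `(γ, b) ↦ (γ, ¬ b → p γ)` gives truth values `b₁, b₂` on `X` with `(¬ b₁ → p) = ⊤` and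
`(¬ b₂ → p) = p` that agree at all global elements, whence `¬ b₁ = ¬ b₂` and `p = ⊤`.

Equality of arrows into `Ω` is checked on generalized elements (`omega_ext`), as in Kripke–Joyal
semantics, so that the connectives are needed only through their forcing conditions.
-/

namespace EpsilonTopos

/-! ### Truth values and their forcing conditions -/

section Forcing

variable {C : Type u} [Category.{v} C]

theorem comp_χ_eq_trueMap_iff (c : Subobject.Classifier C) {U X T : C} (m : U ⟶ X) [Mono m]
    (t : T ⟶ X) : t ≫ c.χ m = trueMap c T ↔ ∃ l, l ≫ m = t := by
  constructor
  · intro h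
    exact ⟨(c.isPullback m).lift t (c.χ₀ T) h, (c.isPullback m).lift_fst _ _ _⟩
  · rintro ⟨l, rfl⟩
    rw [Category.assoc, (c.isPullback m).w]
    exact comp_trueMap c l

/-- Extensionality of truth values: an arrow into `Ω` is determined by the generalized elements at
which it is true. -/
theorem omega_ext [HasFiniteLimits C] (c : Subobject.Classifier C) {X : C} {f g : X ⟶ c.Ω}
    (h : ∀ ⦃T : C⦄ (t : T ⟶ X), t ≫ f = trueMap c T ↔ t ≫ g = trueMap c T) : f = g := by
  obtain ⟨U, i, _, rfl⟩ := c.surjective_χ f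
  refine (c.uniq i (χ₀' := c.χ₀ U) ⟨⟨(h i).1 ((comp_χ_eq_trueMap_iff c i i).2 ⟨𝟙 U, by simp⟩)⟩,
    ⟨PullbackCone.IsLimit.mk _
      (fun s => (c.isPullback i).lift s.fst (c.χ₀ s.pt) ?_)
      (fun s => (c.isPullback i).lift_fst _ _ _)
      (fun s => c.isTerminalΩ₀.hom_ext _ _)
      (fun s l hl _ => ?_)⟩⟩).symm
  · refine (h s.fst).2 ?_
    rw [s.condition, c.isTerminalΩ₀.hom_ext s.snd (c.χ₀ s.pt)]
    rfl
  · exact (cancel_mono i).1 (hl.trans ((c.isPullback i).lift_fst _ _ _).symm)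

variable [HasFiniteLimits C]

/-- The truth value of the equation `f = g` between two arrows. -/
noncomputable def eqv (c : Subobject.Classifier C) {X Y : C} (f g : X ⟶ Y) : X ⟶ c.Ω :=
  c.χ (equalizer.ι f g)

theorem comp_eqv_eq_trueMap_iff (c : Subobject.Classifier C) {X Y T : C} (f g : X ⟶ Y)
    (t : T ⟶ X) : t ≫ eqv c f g = trueMap c T ↔ t ≫ f = t ≫ g := by
  rw [eqv, comp_χ_eq_trueMap_iff]
  constructor
  · rintro ⟨l, rfl⟩
    rw [Category.assoc, Category.assoc, equalizer.condition]
  · exact fun h => ⟨equalizer.lift t h, equalizer.lift_ι _ _⟩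

theorem comp_eqv (c : Subobject.Classifier C) {X Y T : C} (f g : X ⟶ Y) (t : T ⟶ X) :
    t ≫ eqv c f g = eqv c (t ≫ f) (t ≫ g) :=
  omega_ext c fun S s => by
    rw [← Category.assoc, comp_eqv_eq_trueMap_iff, comp_eqv_eq_trueMap_iff]
    simp

variable [CartesianMonoidalCategory C]

/-- The truth value of an implication, encoded as the equation `p = (p ∧ q)`, the conjunction being
the equation `(p, q) = (⊤, ⊤)`. -/
noncomputable def imp (c : Subobject.Classifier C) {X : C} (p q : X ⟶ c.Ω) : X ⟶ c.Ω :=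
  eqv c p (eqv c (lift p q) (lift (trueMap c X) (trueMap c X)))

theorem comp_imp (c : Subobject.Classifier C) {X T : C} (p q : X ⟶ c.Ω) (t : T ⟶ X) :
    t ≫ imp c p q = imp c (t ≫ p) (t ≫ q) := by
  simp [imp, comp_eqv, comp_lift, comp_trueMap]

/-- The forcing condition of the conjunction that occurs in `imp`. -/
theorem comp_conj_eq_trueMap_iff (c : Subobject.Classifier C) {X T : C} (p q : X ⟶ c.Ω)
    (t : T ⟶ X) :
    t ≫ eqv c (lift p q) (lift (trueMap c X) (trueMap c X)) = trueMap c T ↔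
      t ≫ p = trueMap c T ∧ t ≫ q = trueMap c T := by
  rw [comp_eqv_eq_trueMap_iff, comp_lift, comp_lift, comp_trueMap]
  constructor
  · intro h
    exact ⟨by simpa using congr($h ≫ fst _ _), by simpa using congr($h ≫ snd _ _)⟩
  · rintro ⟨h₁, h₂⟩
    rw [h₁, h₂]

theorem comp_imp_eq_trueMap_iff (c : Subobject.Classifier C) {X T : C} (p q : X ⟶ c.Ω)
    (t : T ⟶ X) : t ≫ imp c p q = trueMap c T ↔
      ∀ ⦃S : C⦄ (s : S ⟶ T), s ≫ t ≫ p = trueMap c S → s ≫ t ≫ q = trueMap c S := by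
  rw [imp, comp_eqv_eq_trueMap_iff]
  constructor
  · intro h S s hs
    rw [h, ← Category.assoc, comp_conj_eq_trueMap_iff] at hs
    simpa using hs.2
  · refine fun h => omega_ext c fun S s => ?_
    rw [← Category.assoc s t (eqv _ _ _), comp_conj_eq_trueMap_iff]
    simpa using h s

theorem imp_trueMap_left (c : Subobject.Classifier C) {X : C} (q : X ⟶ c.Ω) :
    imp c (trueMap c X) q = q :=
  omega_ext c fun T t => by
    rw [comp_imp_eq_trueMap_iff]
    constructor
    · intro h
      simpa using h (𝟙 T) (by simp [comp_trueMap])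
    · intro h S s _
      rw [h, comp_trueMap]

end Forcing

/-! ### Global elements in an `ε`-topos -/

section EpsilonTopos

variable {C : Type u} [Category.{v} C] [CartesianMonoidalCategory C]

/-- In an `ε`-topos, an object that is not initial has a global element. -/
theorem IsEpsilonTopos.exists_point (hC : IsEpsilonTopos C) {A : C} (hA : ¬ IsInitialObj A) :
    Nonempty (𝟙_ C ⟶ A) := by
  obtain ⟨s, -⟩ := hC.1 _ (hC.2 A hA)
  exact ⟨s⟩

theorem IsInitialObj.of_hom [MonoidalClosed C] {A B : C} (f : A ⟶ B) (hB : IsInitialObj B) :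
    IsInitialObj A := by
  obtain ⟨h⟩ := hB
  have := strict_initial h f
  exact ⟨h.ofIso (asIso f).symm⟩

/-- The constant map with value "false", the characteristic map of the empty subobject. -/
noncomputable def falseMap [MonoidalClosed C] [HasInitial C] (c : Subobject.Classifier C) (X : C) :
    X ⟶ c.Ω := c.χ (initial.to X)

theorem comp_falseMap_eq_trueMap_iff [MonoidalClosed C] [HasInitial C]
    (c : Subobject.Classifier C) {X T : C} (t : T ⟶ X) :
    t ≫ falseMap c X = trueMap c T ↔ IsInitialObj T := by
  rw [falseMap, comp_χ_eq_trueMap_iff]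
  constructor
  · rintro ⟨l, -⟩
    exact .of_hom l ⟨initialIsInitial⟩
  · rintro ⟨h⟩
    exact ⟨h.to _, h.hom_ext _ _⟩

variable [HasFiniteLimits C]

/-- If no object were initial, then every equalizer of arrows `f, g : 1 ⟶ A` would have a global
element, so that `f = g`, and the terminal object would be initial after all. -/
theorem IsEpsilonTopos.hasInitial (hC : IsEpsilonTopos C) : HasInitial C := by
  by_contra hI
  have hpt (A : C) : Nonempty (𝟙_ C ⟶ A) :=
    hC.exists_point fun ⟨h⟩ => hI h.hasInitial
  have heq {A : C} (f g : 𝟙_ C ⟶ A) : f = g := by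
    obtain ⟨p⟩ := hpt (equalizer f g)
    have h := p ≫= equalizer.condition f g
    rwa [← Category.assoc, ← Category.assoc, toUnit_unique (p ≫ equalizer.ι f g) (𝟙 _),
      Category.id_comp, Category.id_comp] at h
  exact hI (IsInitial.hasInitial (X := 𝟙_ C) (IsInitial.ofUniqueHom (fun A => (hpt A).some)
    fun _ _ => heq _ _))

variable [MonoidalClosed C]

section Negation

variable [HasInitial C] (c : Subobject.Classifier C)

theorem comp_falseMap {X T : C} (t : T ⟶ X) : t ≫ falseMap c X = falseMap c T :=
  omega_ext c fun S s => by
    rw [← Category.assoc, comp_falseMap_eq_trueMap_iff, comp_falseMap_eq_trueMap_iff]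

/-- Any truth value is implied by "false". -/
theorem imp_falseMap_left {X : C} (q : X ⟶ c.Ω) : imp c (falseMap c X) q = trueMap c X := by
  rw [← Category.id_comp (imp c _ q), comp_imp_eq_trueMap_iff]
  intro S s hs
  rw [Category.id_comp, comp_falseMap_eq_trueMap_iff] at hs
  exact hs.some.hom_ext _ _

/-- The truth value of a negation, encoded as the equation `p = ⊥`. -/
noncomputable def neg {X : C} (p : X ⟶ c.Ω) : X ⟶ c.Ω := eqv c p (falseMap c X)

theorem comp_neg {X T : C} (p : X ⟶ c.Ω) (t : T ⟶ X) : t ≫ neg c p = neg c (t ≫ p) := by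
  rw [neg, comp_eqv, comp_falseMap, neg]

theorem neg_trueMap (X : C) : neg c (trueMap c X) = falseMap c X :=
  omega_ext c fun T t => by
    rw [neg, comp_eqv_eq_trueMap_iff, comp_trueMap, eq_comm]

theorem neg_falseMap (X : C) : neg c (falseMap c X) = trueMap c X := by
  rw [← Category.id_comp (neg c _), neg, comp_eqv_eq_trueMap_iff]

variable {c}

/-- In an `ε`-topos, a truth value with no true global instance is false. -/
theorem IsEpsilonTopos.eq_falseMap (hC : IsEpsilonTopos C) {X : C} {p : X ⟶ c.Ω}
    (h : ∀ x : 𝟙_ C ⟶ X, x ≫ p ≠ trueMap c _) : p = falseMap c X :=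
  omega_ext c fun T t => by
    rw [comp_falseMap_eq_trueMap_iff]
    constructor
    · intro ht
      by_contra hT
      obtain ⟨x⟩ := hC.exists_point hT
      exact h (x ≫ t) (by rw [Category.assoc, ht, comp_trueMap])
    · rintro ⟨hT⟩
      exact hT.hom_ext _ _

/-- Negated truth values are determined by their global instances, since `¬ p` holds over `T` as
soon as `p` is not true at any global element of `T`. -/
theorem IsEpsilonTopos.neg_eq_neg (hC : IsEpsilonTopos C) {X : C} {p q : X ⟶ c.Ω}
    (h : ∀ x : 𝟙_ C ⟶ X, x ≫ p = x ≫ q) : neg c p = neg c q := by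
  have key {p q : X ⟶ c.Ω} (h : ∀ x : 𝟙_ C ⟶ X, x ≫ p = x ≫ q) {T : C} (t : T ⟶ X)
      (ht : t ≫ p = t ≫ falseMap c X) : t ≫ q = t ≫ falseMap c X := by
    by_cases hT : IsInitialObj T
    · exact hT.some.hom_ext _ _
    rw [comp_falseMap]
    refine hC.eq_falseMap fun x hx => hT (.of_hom (toUnit T) ?_)
    rw [← comp_falseMap_eq_trueMap_iff c (x ≫ t), Category.assoc, ← ht, ← Category.assoc, h,
      Category.assoc, hx]
  refine omega_ext c fun T t => ?_
  rw [neg, neg, comp_eqv_eq_trueMap_iff, comp_eqv_eq_trueMap_iff]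
  exact ⟨key h t, key (fun x => (h x).symm) t⟩

/-- In an `ε`-topos, a truth value that is true at all global elements is true. This is Diaconescu's
argument: choose preimages for `(γ, b) ↦ (γ, ¬ b → p γ)`, an endomorphism of `X ⊗ Ω`. The values
`(γ, ⊤)` and `(γ, p γ)`, taken at `b = ⊤` and `b = ⊥`, agree at all global elements, hence so do the
chosen preimages, whose second components then have the same negation. -/
theorem IsEpsilonTopos.eq_trueMap [HasSubobjectClassifier C] (hC : IsEpsilonTopos C) {X : C}
    {p : X ⟶ c.Ω} (h : ∀ x : 𝟙_ C ⟶ X, x ≫ p = trueMap c _) : p = trueMap c X := by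
  let F : X ⊗ c.Ω ⟶ c.Ω := imp c (neg c (snd _ _)) (fst _ _ ≫ p)
  have hF (b : X ⟶ c.Ω) : lift (𝟙 X) b ≫ F = imp c (neg c b) p := by
    simp [F, comp_imp, comp_neg]
  let e : X ⊗ c.Ω ⟶ X ⊗ c.Ω := lift (fst _ _) F
  have he (b : X ⟶ c.Ω) : lift (𝟙 X) b ≫ e = lift (𝟙 X) (imp c (neg c b) p) := by
    simp [e, comp_lift, hF]
  obtain ⟨s, hs⟩ := hC.1 (factorThruImage e) inferInstance
  have hse : s ≫ e = image.ι e :=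
    (s ≫= (image.fac e).symm).trans (by rw [← Category.assoc, hs, Category.id_comp])
  -- The chosen preimage of the value of `e` at `(γ, b γ)`; it again has first component `γ`.
  let chosen (b : X ⟶ c.Ω) : X ⟶ X ⊗ c.Ω := lift (𝟙 X) b ≫ factorThruImage e ≫ s
  have hchosen_e (b : X ⟶ c.Ω) : chosen b ≫ e = lift (𝟙 X) (imp c (neg c b) p) := by
    simp only [chosen, Category.assoc, hse, image.fac, he]
  have hchosen (b : X ⟶ c.Ω) : chosen b = lift (𝟙 X) (chosen b ≫ snd _ _) := by
    ext
    · simpa [e] using congr($(hchosen_e b) ≫ fst _ _)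
    · simp
  have himp (b : X ⟶ c.Ω) : imp c (neg c (chosen b ≫ snd _ _)) p = imp c (neg c b) p := by
    have h₁ := hchosen_e b
    rw [hchosen b, he] at h₁
    simpa using congr($h₁ ≫ snd _ _)
  have htop := himp (trueMap c X)
  have hbot := himp (falseMap c X)
  rw [neg_trueMap, imp_falseMap_left] at htop
  rw [neg_falseMap, imp_trueMap_left] at hbot
  refine hbot.symm.trans (Eq.trans ?_ htop)
  congr 1
  refine hC.neg_eq_neg fun x => ?_
  -- As `p` is true at `x`, the values of `e` at `(x, ⊥)` and `(x, ⊤)` are both `(x, ⊤)`.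
  suffices x ≫ lift (𝟙 X) (falseMap c X) ≫ factorThruImage e =
      x ≫ lift (𝟙 X) (trueMap c X) ≫ factorThruImage e by
    simpa [chosen] using congr($this ≫ s ≫ snd _ _)
  rw [← cancel_mono (image.ι e)]
  simp only [Category.assoc, image.fac, he, neg_falseMap, neg_trueMap, imp_trueMap_left,
    imp_falseMap_left, comp_lift, h, comp_trueMap]

/-- In an `ε`-topos, an arrow through which all global elements of the codomain lift is epic. -/
theorem IsEpsilonTopos.epi_of_forall_point [HasSubobjectClassifier C] (hC : IsEpsilonTopos C)
    {X Y : C} (f : X ⟶ Y) (h : ∀ y : 𝟙_ C ⟶ Y, ∃ x, x ≫ f = y) : Epi f := by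
  obtain ⟨c⟩ := HasSubobjectClassifier.exists_classifier (C := C)
  refine ⟨fun {Z} g g' hg => ?_⟩
  have : eqv c g g' = trueMap c Y := hC.eq_trueMap fun y => by
    obtain ⟨x, rfl⟩ := h y
    rw [comp_eqv_eq_trueMap_iff, Category.assoc, Category.assoc, hg]
  rwa [← Category.id_comp (eqv c g g'), comp_eqv_eq_trueMap_iff, Category.id_comp,
    Category.id_comp] at this

end Negation

end EpsilonTopos

/-! ### Generalized elements of inverse and direct images -/

section InverseImage

variable {C : Type u} [Category.{v} C] [HasFiniteLimits C]

theorem exists_comp_pullback_arrow_iff {X Y T : C} (f : X ⟶ Y) (S : Subobject Y) (t : T ⟶ X) :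
    (∃ l, l ≫ ((Subobject.pullback f).obj S).arrow = t) ↔ ∃ k, k ≫ S.arrow = t ≫ f := by
  constructor
  · rintro ⟨l, rfl⟩
    exact ⟨l ≫ Subobject.pullbackπ f S, by simp [(Subobject.isPullback f S).w]⟩
  · rintro ⟨k, hk⟩
    exact ⟨(Subobject.isPullback f S).lift k t hk, (Subobject.isPullback f S).lift_snd _ _ _⟩

end InverseImage

section Topos

variable {C : Type u} [Category.{v} C] [CartesianMonoidalCategory C] [MonoidalClosed C]
  [HasFiniteLimits C] [HasSubobjectClassifier C]

/-- The object underlying the image of `S` under `f` is a quotient of `S`: with equalizers, the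
first factor of an image factorization is epic. -/
theorem exists_epi_comp_exists_arrow {X Y : C} (f : X ⟶ Y) (S : Subobject X) :
    ∃ e : (S : C) ⟶ ((Subobject.exists f).obj S : C),
      Epi e ∧ e ≫ ((Subobject.exists f).obj S).arrow = S.arrow ≫ f := by
  let F := Subobject.imageFactorisation f S
  refine ⟨F.F.e, ?_, F.F.fac⟩
  have h := (Image.isImage (S.arrow ≫ f)).e_isoExt_hom F.isImage
  exact h ▸ epi_comp' (inferInstanceAs (Epi (factorThruImage (S.arrow ≫ f))))
    (@IsIso.epi_of_iso _ _ _ _ _ (Iso.isIso_hom _))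

/-- If epimorphisms split, then a generalized element of the image of `S` under `f` lifts to `S`
without passing to a cover. -/
theorem exists_comp_exists_arrow_iff
    (hC : ∀ ⦃X Y : C⦄ (f : X ⟶ Y), Epi f → ∃ s : Y ⟶ X, s ≫ f = 𝟙 Y) {X Y T : C} (f : X ⟶ Y)
    (S : Subobject X) (t : T ⟶ Y) :
    (∃ l, l ≫ ((Subobject.exists f).obj S).arrow = t) ↔ ∃ k, k ≫ S.arrow ≫ f = t := by
  obtain ⟨e, he, hfac⟩ := exists_epi_comp_exists_arrow f S
  obtain ⟨s, hs⟩ := hC e he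
  constructor
  · rintro ⟨l, rfl⟩
    refine ⟨l ≫ s, ?_⟩
    rw [← hfac, Category.assoc, ← Category.assoc s, hs, Category.id_comp]
  · rintro ⟨k, rfl⟩
    exact ⟨k ≫ e, by rw [Category.assoc, hfac]⟩

/-! ### The epsilon calculus and choice -/

/-- The arrow `ε` is read off from a section of the projection to `Γ` of
`R = {(γ, a) | φ(γ, a) ↔ ∃ x, φ(γ, x)}`. Every global element `γ` lifts to `R`: take a witness if
there is one, and any `a` otherwise. -/
theorem IsEpsilonTopos.hasEpsilonArrows (hC : IsEpsilonTopos C) : HasEpsilonArrows C := by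
  intro Γ A hA X φ _
  obtain ⟨c⟩ := HasSubobjectClassifier.exists_classifier (C := C)
  have := hC.hasInitial
  set S := Subobject.mk φ
  set E := (Subobject.exists (fst Γ A)).obj S
  let R := equalizer (c.χ S.arrow) (fst Γ A ≫ c.χ E.arrow)
  let r : R ⟶ Γ ⊗ A := equalizer.ι _ _
  have hr : r ≫ c.χ S.arrow = r ≫ fst Γ A ≫ c.χ E.arrow := equalizer.condition _ _
  have hE {T : C} (t : T ⟶ Γ) : (∃ l, l ≫ E.arrow = t) ↔ ∃ k, k ≫ S.arrow ≫ fst Γ A = t :=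
    exists_comp_exists_arrow_iff hC.1 _ S t
  have hepi : Epi (r ≫ fst Γ A) := by
    refine hC.epi_of_forall_point _ fun x => ?_
    suffices ∃ y : 𝟙_ C ⟶ Γ ⊗ A, y ≫ fst Γ A = x ∧
        y ≫ c.χ S.arrow = y ≫ fst Γ A ≫ c.χ E.arrow by
      obtain ⟨y, rfl, hy⟩ := this
      exact ⟨equalizer.lift y hy, by simp [r]⟩
    by_cases hx : ∃ k, k ≫ S.arrow ≫ fst Γ A = x
    · obtain ⟨k, rfl⟩ := hx
      refine ⟨k ≫ S.arrow, by simp, ?_⟩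
      rw [(comp_χ_eq_trueMap_iff c S.arrow _).2 ⟨k, rfl⟩, ← Category.assoc, eq_comm,
        comp_χ_eq_trueMap_iff, hE]
      exact ⟨k, by simp⟩
    · obtain ⟨a⟩ := hC.exists_point hA
      -- The terminal object has a single global element, so a truth value over it that is not
      -- true is false.
      have hpt {p : 𝟙_ C ⟶ c.Ω} (hp : p ≠ trueMap c _) : p = falseMap c _ :=
        hC.eq_falseMap fun y => by rwa [toUnit_unique y (𝟙 _), Category.id_comp]
      refine ⟨lift x a, by simp, ?_⟩
      rw [lift_fst_assoc, hpt (p := lift x a ≫ c.χ S.arrow), hpt (p := x ≫ c.χ E.arrow)]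
      · rwa [Ne, comp_χ_eq_trueMap_iff, hE]
      · rw [Ne, comp_χ_eq_trueMap_iff]
        rintro ⟨k, hk⟩
        exact hx ⟨k, by rw [← Category.assoc, hk, lift_fst]⟩
  obtain ⟨s, hs⟩ := hC.1 _ hepi
  let ε : Γ ⟶ A := s ≫ r ≫ snd Γ A
  have hε : lift (𝟙 Γ) ε = s ≫ r := by
    ext
    · simpa using hs.symm
    · simp [ε]
  have hχ : lift (𝟙 Γ) ε ≫ c.χ S.arrow = c.χ E.arrow := by
    rw [hε, Category.assoc, hr]
    simpa using congr($hs ≫ c.χ E.arrow)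
  have hiff {T : C} (t : T ⟶ Γ) :
      (∃ l, l ≫ ((Subobject.pullback (lift (𝟙 Γ) ε)).obj S).arrow = t) ↔ ∃ l, l ≫ E.arrow = t := by
    rw [exists_comp_pullback_arrow_iff, ← comp_χ_eq_trueMap_iff c, ← comp_χ_eq_trueMap_iff c,
      Category.assoc, hχ]
  refine ⟨ε, le_antisymm ?_ ?_⟩
  · obtain ⟨l, hl⟩ := (hiff _).1 ⟨𝟙 _, Category.id_comp _⟩
    exact Subobject.le_of_comm l hl
  · obtain ⟨l, hl⟩ := (hiff _).2 ⟨𝟙 _, Category.id_comp _⟩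
    exact Subobject.le_of_comm l hl

theorem HasEpsilonArrows.isFullEpsilonCalculus (h : HasEpsilonArrows C) :
    IsFullEpsilonCalculus C := by
  have key (Γ A : C) (hA : ¬ IsInitialObj A) (S : Subobject (Γ ⊗ A)) : ∃ ε : Γ ⟶ A,
      (Subobject.exists (fst Γ A)).obj S ≤ (Subobject.pullback (lift (𝟙 Γ) ε)).obj S := by
    obtain ⟨ε, hε⟩ := h Γ A hA _ S.arrow
    rw [Subobject.mk_arrow] at hε
    exact ⟨ε, hε.ge⟩
  exact fun Γ A _ hA ψ => key (ctxObj Γ) A hA ψ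

/-- If `f` is epic then `∃ x, f x = z` holds for all `z`, so that a term `ε` witnessing it is a
section of `f`. -/
theorem comp_eq_id_of_exists_le_pullback {X Z : C} (f : X ⟶ Z) [Epi f] (m : X ⟶ Z ⊗ X) [Mono m]
    (hf : m ≫ fst Z X = f) (hm : m ≫ snd Z X = 𝟙 X) (ε : Z ⟶ X)
    (h : (Subobject.exists (fst Z X)).obj (Subobject.mk m) ≤
      (Subobject.pullback (lift (𝟙 Z) ε)).obj (Subobject.mk m)) : ε ≫ f = 𝟙 Z := by
  have hfst : (Subobject.mk m).arrow ≫ fst Z X = (Subobject.underlyingIso m).hom ≫ f := by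
    rw [← Subobject.underlyingIso_hom_comp_eq_mk, Category.assoc, hf]
  obtain ⟨e, -, he⟩ := exists_epi_comp_exists_arrow (fst Z X) (Subobject.mk m)
  rw [hfst] at he
  have : Epi ((Subobject.exists (fst Z X)).obj (Subobject.mk m)).arrow :=
    have : Epi (e ≫ ((Subobject.exists (fst Z X)).obj (Subobject.mk m)).arrow) := by
      rw [he]
      exact epi_comp _ _
    epi_of_epi e _
  have := isIso_of_mono_of_epi ((Subobject.exists (fst Z X)).obj (Subobject.mk m)).arrow
  obtain ⟨k, hk⟩ := (exists_comp_pullback_arrow_iff _ _ (𝟙 Z)).1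
    ⟨inv ((Subobject.exists (fst Z X)).obj (Subobject.mk m)).arrow ≫ Subobject.ofLE _ _ h,
      by simp⟩
  rw [← Subobject.underlyingIso_hom_comp_eq_mk, Category.id_comp, ← Category.assoc] at hk
  have h₁ := congr($hk ≫ fst Z X)
  have h₂ := congr($hk ≫ snd Z X)
  simp only [Category.assoc, hf, hm, lift_fst, lift_snd, Category.comp_id] at h₁ h₂
  rw [← h₂, Category.assoc, h₁]

/-- A section of an epimorphism `f : X ⟶ Y` is a term `ε` with `∃ x, f x = y ⊢ f ε = y`, in the
context of a single variable `y : Y`. -/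
theorem IsFullEpsilonCalculus.isEpsilonTopos (h : IsFullEpsilonCalculus C) :
    IsEpsilonTopos C := by
  refine ⟨fun X Y f hf => ?_, fun A hA => ?_⟩
  · by_cases hX : IsInitialObj X
    · have : Mono f := by
        rw [← hX.some.hom_ext (hX.some.to Y) f]
        exact initial_mono Y hX.some
      have := isIso_of_mono_of_epi f
      exact ⟨inv f, by simp⟩
    · have hY : ∀ B ∈ [Y], ¬ IsInitialObj B := by
        simpa using fun hY => hX (.of_hom f hY)
      -- The context `[Y]` is interpreted by `𝟙_ C ⊗ Y`, not by `Y` itself.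
      let g : X ⟶ 𝟙_ C ⊗ Y := f ≫ (λ_ Y).inv
      have : Epi g := epi_comp _ _
      let m : X ⟶ (𝟙_ C ⊗ Y) ⊗ X := lift g (𝟙 X)
      have : Mono m := mono_of_mono_fac (lift_snd g (𝟙 X))
      let S : Subobject ((𝟙_ C ⊗ Y) ⊗ X) := Subobject.mk m
      obtain ⟨ε, hε⟩ : ∃ ε : 𝟙_ C ⊗ Y ⟶ X, (Subobject.exists (fst (𝟙_ C ⊗ Y) X)).obj S ≤
          (Subobject.pullback (lift (𝟙 (𝟙_ C ⊗ Y)) ε)).obj S := h [Y] X hY hX S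
      have hs : ε ≫ g = 𝟙 _ :=
        comp_eq_id_of_exists_le_pullback g m (lift_fst _ _) (lift_snd _ _) ε hε
      refine ⟨(λ_ Y).inv ≫ ε, ?_⟩
      rw [← cancel_mono (λ_ Y).inv, Category.assoc, Category.assoc, Category.id_comp, hs,
        Category.comp_id]
  · obtain ⟨ε, -⟩ := h [] A (by simp) hA ⊤
    have : IsSplitEpi (toUnit A) := IsSplitEpi.mk' ⟨ε, toUnit_unique _ _⟩
    infer_instance

end Topos

end EpsilonTopos

theorem mainTheorem2 (C : Type u) [Category.{v} C] [CartesianMonoidalCategory C]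
    [MonoidalClosed C] [HasFiniteLimits C] [HasSubobjectClassifier C] :
    List.TFAE [EpsilonTopos.IsFullEpsilonCalculus C, EpsilonTopos.HasEpsilonArrows C,
      EpsilonTopos.IsEpsilonTopos C] := by
  tfae_have 1 → 3 := EpsilonTopos.IsFullEpsilonCalculus.isEpsilonTopos
  tfae_have 3 → 2 := EpsilonTopos.IsEpsilonTopos.hasEpsilonArrows
  tfae_have 2 → 1 := EpsilonTopos.HasEpsilonArrows.isFullEpsilonCalculus
  tfae_finish
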